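/- Let $\mathcal X$ be a compact subset of a real normed space, let $\mu$ be a $\sigma$-finite measure on a measurable space $\mathcal Y$, let $M$ be a real number, let $\{f_t : t\in[-M,M]\}$ be a family of probability densities with respect to $\mu$ such that $(t,y)\mapsto f_t(y)$ is measurable, and for each $x\in\mathcal X$ let $f_{0x}$ be a probability density with respect to $\mu$. Write $\mathbb E_x$ for expectation under $f_{0x}$. Let $x_1,x_2,\dots\in\mathcal X$ be a fixed design, and let $Y_1,Y_2,\dots$ be independent with $Y_i\sim f_{0x_i}$; $\mathbb P_0$ denotes the law of $(Y_i)_{i\ge1}$, i.e. the infinite product of the laws $f_{0x_i}\,d\mu$. Let $\Theta$ be a set of continuous functions $\mathcal X\to[-M,M]$ that is compact in the sup norm, let $\Pi$ be a Borel probability measure (the prior) on $\Theta$, and let $\theta^*\in\Theta$. Assume: (B) for all $x_0\in\mathcal X$ and $r>0$, $\displaystyle\liminf_{n\to\infty}\frac1n\#\{i\le n:\|x_i-x_0\|<r\}>0$; (C) for every $x\in\mathcal X$, $\theta^*(x)$ minimises over $t\in[-M,M]$ the Kullback–Leibler divergence $\mathbb E_x\log\frac{f_{0x}}{f_t}\in[0,\infty]$,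 and for every $\eta>0$, $\Pi\big(\theta:\sup_x|\theta(x)-\theta^*(x)|<\eta\big)>0$; (D) for all $x\in\mathcal X$ and $t\in[-M,M]$, $f_t>0$ holds almost surely under $f_{0x}$; the expectations $\mathbb E_x\big[\log\frac{f_t}{f_{t'}}\big]$ and, for every $\alpha\in[0,1]$, $\mathbb E_x\big[(\frac{f_t}{f_{t'}})^\alpha\big]$ exist, are finite and are continuous in $(x,t,t')\in\mathcal X\times[-M,M]^2$; and $\mathbb E_x\big[\log^2\frac{f_t}{f_{t'}}\big]$ is uniformly bounded on $\mathcal X\times[-M,M]^2$; (E) for every $\epsilon>0$ there is $\delta\in(0,1)$ such that for all $x\in\mathcal X$ and $t\in[-M,M]$, $\mathbb E_x\log\frac{f_{\theta^*(x)}}{f_t}<\delta$ implies $|t-\theta^*(x)|<\epsilon$. For measurable $A\subseteq\Theta$ define the posterior probability $$\Pi(A\mid Y_{1:n})=\frac{\int_A\prod_{i=1}^n\frac{f_{\theta(x_i)}(Y_i)}{f_{\theta^*(x_i)}(Y_i)}\,d\Pi(\theta)}{\int_\Theta\prod_{i=1}^n\frac{f_{\theta(x_i)}(Y_i)}{f_{\theta^*(x_i)}(Y_i)}\,d\Pi(\theta)}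 .$$ Then for every $\epsilon>0$, $\mathbb P_0$-almost surely: the denominator is positive and finite for every $n$ (so the posterior is well defined), and $$\Pi\Big(\Big\{\theta\in\Theta:\sup_{x\in\mathcal X}|\theta(x)-\theta^*(x)|>\epsilon\Big\}\,\Big|\,Y_{1:n}\Big)\longrightarrow0\qquad(n\to\infty).$$ -/

import Mathlib

open MeasureTheory Filter Topology
open scoped ENNReal

/-- A probability density with respect to the measure `μ`. -/
structure ProbDensity {Y : Type*} [MeasurableSpace Y] (μ : Measure Y) where
  toFun : Y → ℝ
  measurable_toFun : Measurable toFun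
  nonneg : ∀ y, 0 ≤ toFun y
  lintegral_eq_one : ∫⁻ y, ENNReal.ofReal (toFun y) ∂μ = 1

namespace ProbDensity

variable {Y : Type*} [MeasurableSpace Y] {μ : Measure Y}

instance : CoeFun (ProbDensity μ) (fun _ => Y → ℝ) := ⟨toFun⟩

/-- The probability measure `g dμ` of a density `g`. -/
noncomputable def law (g : ProbDensity μ) : Measure Y :=
  μ.withDensity (fun y => ENNReal.ofReal (g y))

instance (g : ProbDensity μ) : IsProbabilityMeasure g.law :=
  ⟨by rw [law, withDensity_apply _ MeasurableSet.univ, Measure.restrict_univ]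
      exact g.lintegral_eq_one⟩

end ProbDensity

namespace INID

section Model

variable {E : Type*} [NormedAddCommGroup E] {X : Set E}
  {Y : Type*} [MeasurableSpace Y] {μ : Measure Y} {M : ℝ}

/-- The sup-norm distance `sup_x |θ x - θ' x|` of two functions with values in `[-M, M]`. -/
noncomputable def supDist (θ θ' : C(X, Set.Icc (-M) M)) : ℝ :=
  ⨆ z : X, |(θ z : ℝ) - (θ' z : ℝ)|

/-- The design visits every ball `{z : ‖z - x₀‖ < r}` with positive lower frequency. -/
def DesignCondition (x : ℕ → X) : Prop :=
  ∀ x₀ : X, ∀ r : ℝ, 0 < r →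
    0 < liminf (fun n : ℕ => (1 / (n : ℝ)) *
      ∑ i ∈ Finset.range n, Set.indicator {z : E | ‖z - x₀‖ < r} (fun _ => (1 : ℝ)) (x i)) atTop

/-- At every covariate value `z`, the parameter `θ* z` minimises over `t ∈ [-M, M]` the
Kullback-Leibler divergence `E_z log (f₀_z / f_t)`. -/
def IsKLMinimizer (f₀ : X → ProbDensity μ) (f : Set.Icc (-M) M → ProbDensity μ)
    (θstar : C(X, Set.Icc (-M) M)) : Prop :=
  ∀ z : X, ∀ t : Set.Icc (-M) M,
    InformationTheory.klDiv (f₀ z).law (f (θstar z)).law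
      ≤ InformationTheory.klDiv (f₀ z).law (f t).law

/-- `θ*` lies in the sup-norm support of the prior on `Θ`. -/
def InSupNormSupport {Θ : Set C(X, Set.Icc (-M) M)} [MeasurableSpace C(X, Set.Icc (-M) M)]
    (prior : Measure Θ) (θstar : Θ) : Prop :=
  ∀ η : ℝ, 0 < η → 0 < prior {θ : Θ | supDist (θ : C(X, Set.Icc (-M) M)) θstar < η}

/-- Continuity and moment conditions on the likelihood ratios `f_t / f_t'` under `f₀_z`.
The first clause and the integrability clauses say that the expectations that follow are
well defined and finite: `log (f_t / f_t')` is a finite number almost surely only where both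
densities are positive. -/
structure RatioRegularity (f₀ : X → ProbDensity μ) (f : Set.Icc (-M) M → ProbDensity μ) :
    Prop where
  ae_pos : ∀ (z : X) (t : Set.Icc (-M) M), ∀ᵐ y ∂(f₀ z).law, 0 < f t y
  integrable_log : ∀ (z : X) (t t' : Set.Icc (-M) M),
    Integrable (fun y => Real.log (f t y / f t' y)) (f₀ z).law
  continuous_log : Continuous fun p : X × Set.Icc (-M) M × Set.Icc (-M) M =>
    ∫ y, Real.log (f p.2.1 y / f p.2.2 y) ∂(f₀ p.1).law
  integrable_rpow : ∀ α ∈ Set.Icc (0 : ℝ) 1, ∀ (z : X) (t t' : Set.Icc (-M) M),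
    Integrable (fun y => (f t y / f t' y) ^ α) (f₀ z).law
  continuous_rpow : ∀ α ∈ Set.Icc (0 : ℝ) 1,
    Continuous fun p : X × Set.Icc (-M) M × Set.Icc (-M) M =>
      ∫ y, (f p.2.1 y / f p.2.2 y) ^ α ∂(f₀ p.1).law
  integrable_log_sq : ∀ (z : X) (t t' : Set.Icc (-M) M),
    Integrable (fun y => Real.log (f t y / f t' y) ^ 2) (f₀ z).law
  log_sq_bounded : ∃ C : ℝ, ∀ (z : X) (t t' : Set.Icc (-M) M),
    ∫ y, Real.log (f t y / f t' y) ^ 2 ∂(f₀ z).law ≤ C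

/-- Separation of parameter values by the Kullback-Leibler excess, uniformly in `z`. -/
def KLSeparation (f₀ : X → ProbDensity μ) (f : Set.Icc (-M) M → ProbDensity μ)
    (θstar : C(X, Set.Icc (-M) M)) : Prop :=
  ∀ ε : ℝ, 0 < ε → ∃ δ ∈ Set.Ioo (0 : ℝ) 1, ∀ (z : X) (t : Set.Icc (-M) M),
    ∫ y, Real.log (f (θstar z) y / f t y) ∂(f₀ z).law < δ → |(t : ℝ) - (θstar z : ℝ)| < ε

/-- The likelihood ratio `∏_{i < n} f_{θ (x i)} (y i) / f_{θ* (x i)} (y i)`. -/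
noncomputable def likelihoodRatio (f : Set.Icc (-M) M → ProbDensity μ) (x : ℕ → X)
    (θstar θ : C(X, Set.Icc (-M) M)) (n : ℕ) (y : ℕ → Y) : ℝ :=
  ∏ i ∈ Finset.range n, f (θ (x i)) (y i) / f (θstar (x i)) (y i)

/-- The integral of the likelihood ratio over `A` with respect to the prior. -/
noncomputable def partialEvidence {Θ : Set C(X, Set.Icc (-M) M)}
    [MeasurableSpace C(X, Set.Icc (-M) M)] (f : Set.Icc (-M) M → ProbDensity μ) (x : ℕ → X)
    (prior : Measure Θ) (θstar : Θ) (A : Set Θ) (n : ℕ) (y : ℕ → Y) : ℝ≥0∞ :=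
  ∫⁻ θ in A, ENNReal.ofReal (likelihoodRatio f x θstar θ n y) ∂prior

/-- The posterior probability of `A` given the first `n` responses. -/
noncomputable def posterior {Θ : Set C(X, Set.Icc (-M) M)}
    [MeasurableSpace C(X, Set.Icc (-M) M)] (f : Set.Icc (-M) M → ProbDensity μ) (x : ℕ → X)
    (prior : Measure Θ) (θstar : Θ) (A : Set Θ) (n : ℕ) (y : ℕ → Y) : ℝ≥0∞ :=
  partialEvidence f x prior θstar A n y / partialEvidence f x prior θstar Set.univ n y

/-- The law of the sequence of independent responses `Y i ∼ f₀_{x i}`. -/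
noncomputable def trueLaw (f₀ : X → ProbDensity μ) (x : ℕ → X) : Measure (ℕ → Y) :=
  Measure.infinitePi fun i => (f₀ (x i)).law

end Model

end INID

/-! Every random quantity is compared through its exponential growth rate in `n`. By Markov's
inequality and Borel–Cantelli, the rate of a nonnegative random sequence is almost surely at most
the rate of its means.

Fix `θ ≠ θ*`. The quotients `(g ^ p - 1) / p` decrease to `log g` as `p ↓ 0`, so by Dini's theorem
some small `p` satisfies `𝔼_z[g ^ p] ≤ exp (p (𝔼_z[log g] + s))` uniformly in `z`, where `g` is the
ratio of the densities of `θ z` and `θ* z`. The mean log ratios are nonpositive, and they are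
negative near some point, which the design visits with positive frequency, so the likelihood ratio
of `θ` against `θ*` has negative rate. Exchanging `θ` for a sup-norm close parameter costs an
arbitrarily small rate, so by compactness the evidence outside a neighbourhood of `θ*` has negative
rate. By Cauchy–Schwarz the evidence of a small ball around `θ*` is at least its squared prior mass
divided by the integral of the reversed likelihood ratios, hence the total evidence has nonnegative
rate. The posterior therefore decays exponentially.
-/

namespace INID

open ExpGrowth

theorem expGrowthSup_rpow (u : ℕ → ℝ≥0∞) {p : ℝ} (hp : 0 ≤ p) :
    expGrowthSup (fun n => u n ^ p) = p * expGrowthSup u := by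
  simp only [expGrowthSup, ENNReal.log_rpow, ← EReal.mul_div]
  exact EReal.limsup_const_mul_of_nonneg_of_ne_top (EReal.coe_nonneg.2 hp) (EReal.coe_ne_top p)

theorem expGrowthSup_le_of_le_ofReal_exp {u : ℕ → ℝ≥0∞} {c : ℝ}
    (h : ∀ᶠ n : ℕ in atTop, u n ≤ ENNReal.ofReal (Real.exp (n * c))) : expGrowthSup u ≤ c := by
  refine Eventually.expGrowthSup_le (h.mono fun n hn => hn.trans_eq ?_)
  rw [← EReal.exp_coe, EReal.coe_mul, mul_comm, EReal.coe_natCast]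

theorem tendsto_zero_of_expGrowthSup_neg {u : ℕ → ℝ≥0∞} (h : expGrowthSup u < 0) :
    Tendsto u atTop (𝓝 0) := by
  obtain ⟨c, huc, hc⟩ := exists_between h
  refine tendsto_of_tendsto_of_tendsto_of_le_of_le' tendsto_const_nhds
    (ENNReal.tendsto_pow_atTop_nhds_zero_of_lt_one (EReal.exp_lt_one_iff.2 hc))
    (Eventually.of_forall fun _ => zero_le) ?_
  filter_upwards [eventually_le_exp huc] with n hn
  rwa [mul_comm, EReal.exp_nmul] at hn

theorem expGrowthSup_div_le {u v : ℕ → ℝ≥0∞} (hv : 0 ≤ expGrowthInf v) :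
    expGrowthSup (u / v) ≤ expGrowthSup u := by
  rcases eq_or_ne (expGrowthSup u) ⊤ with hu | hu
  · rw [hu]
    exact le_top
  have hv' : expGrowthSup v⁻¹ ≤ 0 := by
    rw [expGrowthSup_inv]
    exact EReal.neg_le_zero.2 hv
  calc expGrowthSup (u / v) = expGrowthSup (u * v⁻¹) := by rw [div_eq_mul_inv]
    _ ≤ expGrowthSup u + expGrowthSup v⁻¹ :=
      expGrowthSup_mul_le (.inr (hv'.trans_lt EReal.zero_lt_top).ne) (.inl hu)
    _ ≤ expGrowthSup u := add_le_of_nonpos_right hv'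

theorem ae_eventually_lt_exp_of_expGrowthSup_lintegral_lt {Ω : Type*} [MeasurableSpace Ω]
    {P : Measure Ω} {F : ℕ → Ω → ℝ≥0∞} (hF : ∀ n, AEMeasurable (F n) P) {b : EReal}
    (hb : expGrowthSup (fun n => ∫⁻ ω, F n ω ∂P) < b) (hb' : b ≠ ⊤) :
    ∀ᵐ ω ∂P, ∀ᶠ n : ℕ in atTop, F n ω < EReal.exp (b * n) := by
  obtain ⟨a, ha, hab⟩ := exists_between hb
  obtain ⟨N, hN⟩ := eventually_atTop.1 (eventually_le_exp ha)
  have hb0 : EReal.exp b ≠ 0 := (EReal.zero_lt_exp_iff.2 (bot_le.trans_lt hab)).ne'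
  have hbt : EReal.exp b ≠ ∞ := EReal.exp_eq_top_iff.not.2 hb'
  have hexp (c : EReal) (n : ℕ) : EReal.exp (c * n) = EReal.exp c ^ n := by
    rw [mul_comm, EReal.exp_nmul]
  have hmarkov (n : ℕ) : P {ω | EReal.exp (b * (n + N : ℕ)) ≤ F (n + N) ω}
      ≤ (EReal.exp a / EReal.exp b) ^ (n + N) := by
    rw [hexp]
    refine (meas_ge_le_lintegral_div (hF _) (pow_ne_zero _ hb0) (ENNReal.pow_ne_top hbt)).trans ?_
    rw [div_eq_mul_inv (EReal.exp a), mul_pow, ← ENNReal.inv_pow, ← div_eq_mul_inv, ← hexp a]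
    gcongr
    exact hN _ (Nat.le_add_left _ _)
  have hratio : EReal.exp a / EReal.exp b < 1 :=
    ENNReal.div_lt_of_lt_mul (by rwa [one_mul, EReal.exp_lt_exp_iff])
  have hsum : ∑' n, P {ω | EReal.exp (b * (n + N : ℕ)) ≤ F (n + N) ω} ≠ ∞ := by
    refine ne_top_of_le_ne_top ?_ (ENNReal.tsum_le_tsum hmarkov)
    simp_rw [pow_add]
    rw [ENNReal.tsum_mul_right, ENNReal.tsum_geometric]
    exact ENNReal.mul_ne_top (ENNReal.inv_ne_top.2 (tsub_pos_of_lt hratio).ne')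
      (ENNReal.pow_ne_top hratio.ne_top)
  filter_upwards [ae_eventually_notMem hsum] with ω hω
  rw [← map_add_atTop_eq_nat N, eventually_map]
  exact hω.mono fun n hn => not_le.1 hn

theorem ae_expGrowthSup_le_expGrowthSup_lintegral {Ω : Type*} [MeasurableSpace Ω]
    {P : Measure Ω} {F : ℕ → Ω → ℝ≥0∞} (hF : ∀ n, AEMeasurable (F n) P) :
    ∀ᵐ ω ∂P, expGrowthSup (fun n => F n ω) ≤ expGrowthSup (fun n => ∫⁻ ω, F n ω ∂P) := by
  rcases eq_or_ne (expGrowthSup fun n => ∫⁻ ω, F n ω ∂P) ⊤ with htop | htop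
  · exact Eventually.of_forall fun ω => htop ▸ le_top
  obtain ⟨b, -, hb, hlim⟩ := exists_seq_strictAnti_tendsto' (lt_top_iff_ne_top.2 htop)
  have hae := ae_all_iff.2 fun k =>
    ae_eventually_lt_exp_of_expGrowthSup_lintegral_lt hF (hb k).1 (hb k).2.ne
  filter_upwards [hae] with ω hω
  exact ge_of_tendsto' hlim fun k =>
    Eventually.expGrowthSup_le ((hω k).mono fun _ => le_of_lt)

theorem ae_expGrowthSup_le_of_expGrowthSup_lintegral_rpow_le {Ω : Type*} [MeasurableSpace Ω]
    {P : Measure Ω} {F : ℕ → Ω → ℝ≥0∞} (hF : ∀ n, AEMeasurable (F n) P) {p c : ℝ} (hp : 0 < p)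
    (h : expGrowthSup (fun n => ∫⁻ ω, F n ω ^ p ∂P) ≤ (p * c : ℝ)) :
    ∀ᵐ ω ∂P, expGrowthSup (fun n => F n ω) ≤ c := by
  filter_upwards [ae_expGrowthSup_le_expGrowthSup_lintegral fun n => (hF n).pow_const p]
    with ω hω
  calc expGrowthSup (fun n => F n ω) = expGrowthSup fun n => (F n ω ^ p) ^ p⁻¹ := by
        simp_rw [ENNReal.rpow_rpow_inv hp.ne']
    _ = (p⁻¹ : ℝ) * expGrowthSup fun n => F n ω ^ p := expGrowthSup_rpow _ (inv_nonneg.2 hp.le)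
    _ ≤ (p⁻¹ : ℝ) * (p * c : ℝ) :=
      mul_le_mul_of_nonneg_left (hω.trans h) (EReal.coe_nonneg.2 (inv_nonneg.2 hp.le))
    _ = c := by rw [← EReal.coe_mul, inv_mul_cancel_left₀ hp.ne']

theorem measure_univ_sq_le_lintegral_mul_lintegral_inv {α : Type*} [MeasurableSpace α]
    {ν : Measure α} {f : α → ℝ≥0∞} (hf : AEMeasurable f ν) (h0 : ∀ᵐ a ∂ν, f a ≠ 0)
    (htop : ∀ᵐ a ∂ν, f a ≠ ∞) :
    ν Set.univ ^ 2 ≤ (∫⁻ a, f a ∂ν) * ∫⁻ a, (f a)⁻¹ ∂ν := by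
  have hone : ν Set.univ = ∫⁻ a, f a ^ (1 / 2 : ℝ) * (f a)⁻¹ ^ (1 / 2 : ℝ) ∂ν := by
    rw [← lintegral_one]
    refine lintegral_congr_ae ?_
    filter_upwards [h0, htop] with a ha ha'
    rw [← ENNReal.mul_rpow_of_nonneg _ _ (by norm_num), ENNReal.mul_inv_cancel ha ha',
      ENNReal.one_rpow]
  have hCS := ENNReal.lintegral_mul_norm_pow_le hf hf.inv (p := 1 / 2) (q := 1 / 2)
    (by norm_num) (by norm_num) (by norm_num)
  simp only [Pi.inv_apply] at hCS
  rw [← ENNReal.mul_rpow_of_nonneg _ _ (by norm_num), ← hone] at hCS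
  calc ν Set.univ ^ 2 ≤ (((∫⁻ a, f a ∂ν) * ∫⁻ a, (f a)⁻¹ ∂ν) ^ (1 / 2 : ℝ)) ^ 2 := by
        gcongr
    _ = (∫⁻ a, f a ∂ν) * ∫⁻ a, (f a)⁻¹ ∂ν := by
        rw [← ENNReal.rpow_mul_natCast]
        norm_num

theorem neg_expGrowthSup_lintegral_inv_le {α : Type*} [MeasurableSpace α] {ν : Measure α}
    [NeZero ν] {F : ℕ → α → ℝ≥0∞} (hF : ∀ n, AEMeasurable (F n) ν)
    (h0 : ∀ n, ∀ᵐ a ∂ν, F n a ≠ 0) (htop : ∀ n, ∀ᵐ a ∂ν, F n a ≠ ∞) :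
    -expGrowthSup (fun n => ∫⁻ a, (F n a)⁻¹ ∂ν) ≤ expGrowthInf fun n => ∫⁻ a, F n a ∂ν := by
  rw [← expGrowthInf_inv]
  refine expGrowthInf_of_eventually_ge (pow_ne_zero 2 (NeZero.ne (ν Set.univ)))
    (Eventually.of_forall fun n => ?_)
  rw [Pi.inv_apply, ← div_eq_mul_inv]
  exact ENNReal.div_le_of_le_mul
    (measure_univ_sq_le_lintegral_mul_lintegral_inv (hF n) (h0 n) (htop n))

theorem monotoneOn_inv_mul_rpow_sub_one {x : ℝ} (hx : 0 < x) :
    MonotoneOn (fun p : ℝ => p⁻¹ * (x ^ p - 1)) (Set.Ioi 0) := by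
  intro p (hp : 0 < p) q (hq : 0 < q) hpq
  have hbernoulli : 1 + q / p * (x ^ p - 1) ≤ x ^ q := by
    have h := one_add_mul_self_le_rpow_one_add (s := x ^ p - 1) (p := q / p)
      (by linarith [Real.rpow_pos_of_pos hx p]) ((one_le_div hp).2 hpq)
    rwa [add_sub_cancel, ← Real.rpow_mul hx.le, mul_div_cancel₀ _ hp.ne'] at h
  calc p⁻¹ * (x ^ p - 1) = q⁻¹ * (q / p * (x ^ p - 1)) := by field_simp
    _ ≤ q⁻¹ * (x ^ q - 1) := by gcongr; linarith

theorem tendsto_integral_inv_mul_rpow_sub_one {Ω : Type*} [MeasurableSpace Ω] {P : Measure Ω}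
    [IsFiniteMeasure P] {g : Ω → ℝ} (hpos : ∀ᵐ ω ∂P, 0 < g ω)
    (hlog : Integrable (fun ω => Real.log (g ω)) P) {p : ℕ → ℝ} (hp : Antitone p)
    (hp0 : ∀ n, 0 < p n) (hlim : Tendsto p atTop (𝓝 0))
    (hint : ∀ n, Integrable (fun ω => g ω ^ p n) P) :
    Tendsto (fun n => ∫ ω, (p n)⁻¹ * (g ω ^ p n - 1) ∂P) atTop
      (𝓝 (∫ ω, Real.log (g ω) ∂P)) := by
  refine integral_tendsto_of_tendsto_of_antitone
    (fun n => ((hint n).sub (integrable_const 1)).const_mul _) hlog ?_ ?_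
  · filter_upwards [hpos] with ω hω m n hmn
    exact monotoneOn_inv_mul_rpow_sub_one hω (hp0 n) (hp0 m) (hp hmn)
  · filter_upwards [hpos] with ω hω
    exact (tendsto_rpow_sub_one_log hω).comp
      (tendsto_nhdsWithin_iff.2 ⟨hlim, Eventually.of_forall hp0⟩)

theorem exists_integral_rpow_le {α Ω : Type*} [TopologicalSpace α] [CompactSpace α]
    [MeasurableSpace Ω] {P : α → Measure Ω} [∀ z, IsProbabilityMeasure (P z)] {g : α → Ω → ℝ}
    (hpos : ∀ z, ∀ᵐ ω ∂P z, 0 < g z ω)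
    (hlog : ∀ z, Integrable (fun ω => Real.log (g z ω)) (P z))
    (hlog_cont : Continuous fun z => ∫ ω, Real.log (g z ω) ∂P z)
    (hrpow : ∀ p ∈ Set.Ioc (0 : ℝ) 1, ∀ z, Integrable (fun ω => g z ω ^ p) (P z))
    (hrpow_cont : ∀ p ∈ Set.Ioc (0 : ℝ) 1, Continuous fun z => ∫ ω, g z ω ^ p ∂P z)
    {s : ℝ} (hs : 0 < s) :
    ∃ p ∈ Set.Ioc (0 : ℝ) 1, ∀ z,
      ∫ ω, g z ω ^ p ∂P z ≤ 1 + p * (∫ ω, Real.log (g z ω) ∂P z + s) := by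
  set p : ℕ → ℝ := fun n => 1 / ((n : ℝ) + 1)
  have hp_anti : Antitone p := fun _ _ => Nat.one_div_le_one_div
  have hp (n : ℕ) : p n ∈ Set.Ioc (0 : ℝ) 1 :=
    ⟨Nat.one_div_pos_of_nat, (hp_anti n.zero_le).trans_eq (by norm_num [p])⟩
  have hquot (n : ℕ) (z : α) : ∫ ω, (p n)⁻¹ * (g z ω ^ p n - 1) ∂P z
      = (p n)⁻¹ * (∫ ω, g z ω ^ p n ∂P z - 1) := by
    rw [integral_const_mul, integral_sub (hrpow _ (hp n) z) (integrable_const _), integral_const,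
      probReal_univ, one_smul]
  have hdini := Antitone.tendstoUniformly_of_forall_tendsto
    (F := fun n z => (p n)⁻¹ * (∫ ω, g z ω ^ p n ∂P z - 1))
    (f := fun z => ∫ ω, Real.log (g z ω) ∂P z)
    (fun n => continuous_const.mul ((hrpow_cont _ (hp n)).sub continuous_const))
    (fun m n hmn z => ?_) hlog_cont (fun z => ?_)
  · obtain ⟨n, hn⟩ := (Metric.tendstoUniformly_iff.1 hdini s hs).exists
    refine ⟨p n, hp n, fun z => ?_⟩
    have hz := (abs_sub_lt_iff.1 (hn z)).2
    rw [sub_lt_iff_lt_add', inv_mul_lt_iff₀ (hp n).1] at hz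
    linarith
  · dsimp only
    rw [← hquot, ← hquot]
    have hint (k : ℕ) : Integrable (fun ω => (p k)⁻¹ * (g z ω ^ p k - 1)) (P z) :=
      ((hrpow _ (hp k) z).sub (integrable_const 1)).const_mul _
    refine integral_mono_ae (hint n) (hint m) ?_
    filter_upwards [hpos z] with ω hω
    exact monotoneOn_inv_mul_rpow_sub_one hω (hp n).1 (hp m).1 (hp_anti hmn)
  · simp_rw [← hquot]
    exact tendsto_integral_inv_mul_rpow_sub_one (hpos z) (hlog z) hp_anti (fun n => (hp n).1)
      tendsto_one_div_add_atTop_nhds_zero_nat fun n => hrpow _ (hp n) z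

theorem lintegral_prod_infinitePi {ι : Type*} {Ω : ι → Type*} [∀ i, MeasurableSpace (Ω i)]
    {P : ∀ i, Measure (Ω i)} [∀ i, IsProbabilityMeasure (P i)] {g : ∀ i, Ω i → ℝ≥0∞}
    (hg : ∀ i, Measurable (g i)) (s : Finset ι) :
    ∫⁻ ω, ∏ i ∈ s, g i (ω i) ∂Measure.infinitePi P = ∏ i ∈ s, ∫⁻ u, g i u ∂P i :=
  calc ∫⁻ ω, ∏ i ∈ s, g i (ω i) ∂Measure.infinitePi P
    _ = ∏ i ∈ s, ∫⁻ ω, g i (ω i) ∂Measure.infinitePi P :=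
      ProbabilityTheory.lintegral_prod_eq_prod_lintegral_of_indepFun s _
        (ProbabilityTheory.iIndepFun_infinitePi hg)
        fun i => (hg i).comp (measurable_pi_apply i)
    _ = ∏ i ∈ s, ∫⁻ u, g i u ∂P i := Finset.prod_congr rfl fun i _ =>
      (measurePreserving_eval_infinitePi P i).lintegral_comp (hg i)

section Model

variable {E : Type*} [NormedAddCommGroup E] {X : Set E} {Y : Type*} [MeasurableSpace Y]
  {μ : Measure Y} {M : ℝ} {f₀ : X → ProbDensity μ} {f : Set.Icc (-M) M → ProbDensity μ} {x : ℕ → X}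

theorem supDist_eq_dist [CompactSpace X] (θ θ' : C(X, Set.Icc (-M) M)) :
    supDist θ θ' = dist θ θ' := by
  simp only [supDist, ContinuousMap.dist_eq_iSup, Subtype.dist_eq, Real.dist_eq]

theorem notMem_closure_lt_supDist [CompactSpace X] {Θ : Set C(X, Set.Icc (-M) M)} (θstar : Θ)
    {ε : ℝ} (hε : 0 < ε) :
    θstar ∉ closure {θ : Θ | ε < supDist (θ : C(X, Set.Icc (-M) M)) θstar} := by
  intro hmem
  have hclosed : IsClosed {θ : Θ | ε ≤ dist θ θstar} :=
    isClosed_le continuous_const (continuous_id.dist continuous_const)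
  have hle : ε ≤ dist θstar θstar := closure_minimal
    (fun θ hθ => (le_of_lt hθ).trans_eq (supDist_eq_dist _ _)) hclosed hmem
  exact hle.not_gt (by rwa [dist_self])

theorem DesignCondition.exists_eventually_sum_le (hB : DesignCondition x) {φ : X → ℝ} {z₀ : X}
    (hφ : ContinuousAt φ z₀) (h0 : ∀ z, φ z ≤ 0) (hz₀ : φ z₀ < 0) :
    ∃ κ > 0, ∀ᶠ n : ℕ in atTop, ∑ i ∈ Finset.range n, φ (x i) ≤ -(n * κ) := by
  obtain ⟨r, hr, hball⟩ := Metric.eventually_nhds_iff.1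
    (hφ.eventually_lt_const (show φ z₀ < φ z₀ / 2 by linarith))
  set visit : E → ℝ := Set.indicator {z : E | ‖z - z₀‖ < r} fun _ => 1
  have hφ_le (z : X) : φ z ≤ φ z₀ / 2 * visit z := by
    by_cases hz : (z : E) ∈ {z : E | ‖z - z₀‖ < r}
    · simp only [visit, Set.indicator_of_mem hz, mul_one]
      exact (hball (by rwa [Subtype.dist_eq, dist_eq_norm])).le
    · simp only [visit, Set.indicator_of_notMem hz, mul_zero]
      exact h0 z
  obtain ⟨q, hq, hq_lt⟩ := exists_between (hB z₀ r hr)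
  have hvisit : ∀ᶠ n : ℕ in atTop, q < 1 / (n : ℝ) * ∑ i ∈ Finset.range n, visit (x i) :=
    eventually_lt_of_lt_liminf hq_lt (isBoundedUnder_of ⟨0, fun n =>
      mul_nonneg (by positivity) (Finset.sum_nonneg fun i _ =>
        Set.indicator_nonneg (fun _ _ => zero_le_one) _)⟩)
  refine ⟨-(φ z₀ / 2) * q, mul_pos (by linarith) hq, ?_⟩
  filter_upwards [hvisit, eventually_gt_atTop 0] with n hn hn0
  rw [one_div, lt_inv_mul_iff₀ (Nat.cast_pos.2 hn0)] at hn
  calc ∑ i ∈ Finset.range n, φ (x i) ≤ φ z₀ / 2 * ∑ i ∈ Finset.range n, visit (x i) := by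
        rw [Finset.mul_sum]
        exact Finset.sum_le_sum fun i _ => hφ_le _
    _ ≤ φ z₀ / 2 * (n * q) := mul_le_mul_of_nonpos_left hn.le (by linarith)
    _ = -(n * (-(φ z₀ / 2) * q)) := by ring

theorem measurable_ratio (f : Set.Icc (-M) M → ProbDensity μ) (t t' : Set.Icc (-M) M) :
    Measurable fun y => f t y / f t' y :=
  (f t).measurable_toFun.div (f t').measurable_toFun

theorem ratio_nonneg (f : Set.Icc (-M) M → ProbDensity μ) (t t' : Set.Icc (-M) M) (y : Y) :
    0 ≤ f t y / f t' y :=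
  div_nonneg ((f t).nonneg y) ((f t').nonneg y)

theorem integral_log_ratio_swap (f : Set.Icc (-M) M → ProbDensity μ) (ν : Measure Y)
    (t t' : Set.Icc (-M) M) :
    ∫ y, Real.log (f t y / f t' y) ∂ν = -∫ y, Real.log (f t' y / f t y) ∂ν := by
  simp_rw [← integral_neg, ← Real.log_inv, inv_div]

theorem KLSeparation.integral_log_neg {θstar : C(X, Set.Icc (-M) M)}
    (hE : KLSeparation f₀ f θstar) {z : X} {t : Set.Icc (-M) M} (ht : t ≠ θstar z) :
    ∫ y, Real.log (f t y / f (θstar z) y) ∂(f₀ z).law < 0 := by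
  obtain ⟨δ, hδ, hsep⟩ := hE _ (abs_pos.2 (sub_ne_zero.2 (Subtype.coe_ne_coe.2 ht)))
  rw [integral_log_ratio_swap, neg_lt_zero]
  exact hδ.1.trans_le (not_lt.1 fun h => lt_irrefl _ (hsep z t h))

theorem KLSeparation.integral_log_nonpos {θstar : C(X, Set.Icc (-M) M)}
    (hE : KLSeparation f₀ f θstar) (z : X) (t : Set.Icc (-M) M) :
    ∫ y, Real.log (f t y / f (θstar z) y) ∂(f₀ z).law ≤ 0 := by
  rcases eq_or_ne t (θstar z) with rfl | ht
  · linarith [integral_log_ratio_swap f (f₀ z).law (θstar z) (θstar z)]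
  · exact (hE.integral_log_neg ht).le

theorem RatioRegularity.lintegral_rpow_eq (hD : RatioRegularity f₀ f) {p : ℝ}
    (hp : p ∈ Set.Icc (0 : ℝ) 1) (z : X) (t t' : Set.Icc (-M) M) :
    ∫⁻ y, ENNReal.ofReal (f t y / f t' y) ^ p ∂(f₀ z).law
      = ENNReal.ofReal (∫ y, (f t y / f t' y) ^ p ∂(f₀ z).law) := by
  rw [ofReal_integral_eq_lintegral_ofReal (hD.integrable_rpow p hp z t t')
    (Eventually.of_forall fun _ => Real.rpow_nonneg (ratio_nonneg f t t' _) _)]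
  simp_rw [ENNReal.ofReal_rpow_of_nonneg (ratio_nonneg f t t' _) hp.1]

theorem RatioRegularity.lintegral_ratio_eq (hD : RatioRegularity f₀ f) (z : X)
    (t t' : Set.Icc (-M) M) :
    ∫⁻ y, ENNReal.ofReal (f t y / f t' y) ∂(f₀ z).law
      = ENNReal.ofReal (∫ y, (f t y / f t' y) ^ (1 : ℝ) ∂(f₀ z).law) := by
  simpa only [ENNReal.rpow_one] using hD.lintegral_rpow_eq ⟨zero_le_one, le_rfl⟩ z t t'

theorem RatioRegularity.exists_forall_lintegral_rpow_le [CompactSpace X]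
    (hD : RatioRegularity f₀ f) (a b : C(X, Set.Icc (-M) M)) {s : ℝ} (hs : 0 < s) :
    ∃ p ∈ Set.Ioc (0 : ℝ) 1, ∀ z, ∫⁻ y, ENNReal.ofReal (f (b z) y / f (a z) y) ^ p ∂(f₀ z).law
      ≤ ENNReal.ofReal
        (Real.exp (p * (∫ y, Real.log (f (b z) y / f (a z) y) ∂(f₀ z).law + s))) := by
  have hpath : Continuous fun z : X => (z, b z, a z) := by fun_prop
  have hlog_cont := hD.continuous_log.comp hpath
  have hrpow_cont := fun p hp => (hD.continuous_rpow p hp).comp hpath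
  simp only [Function.comp_def] at hlog_cont hrpow_cont
  obtain ⟨p, hp, hle⟩ := exists_integral_rpow_le (P := fun z => (f₀ z).law)
    (g := fun z y => f (b z) y / f (a z) y)
    (fun z => by
      filter_upwards [hD.ae_pos z (a z), hD.ae_pos z (b z)] with y ha hb using div_pos hb ha)
    (fun z => hD.integrable_log z _ _) hlog_cont
    (fun p hp z => hD.integrable_rpow p (Set.Ioc_subset_Icc_self hp) z _ _)
    (fun p hp => hrpow_cont p (Set.Ioc_subset_Icc_self hp)) hs
  refine ⟨p, hp, fun z => ?_⟩
  rw [hD.lintegral_rpow_eq (Set.Ioc_subset_Icc_self hp)]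
  exact ENNReal.ofReal_le_ofReal ((hle z).trans ((add_comm _ _).trans_le (Real.add_one_le_exp _)))

theorem RatioRegularity.exists_lintegral_ratio_le_exp [CompactSpace X]
    (hD : RatioRegularity f₀ f) {c : ℝ} (hc : 0 < c) :
    ∃ η > 0, ∀ (z : X) (t t' : Set.Icc (-M) M), dist t t' < η →
      ∫⁻ y, ENNReal.ofReal (f t y / f t' y) ∂(f₀ z).law ≤ ENNReal.ofReal (Real.exp c) := by
  obtain ⟨η, hη, hclose⟩ := Metric.uniformContinuous_iff.1
    (CompactSpace.uniformContinuous_of_continuous (hD.continuous_rpow 1 (by simp))) c hc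
  refine ⟨η, hη, fun z t t' htt' => ?_⟩
  have hdiag : ∫ y, (f t' y / f t' y) ^ (1 : ℝ) ∂(f₀ z).law = 1 := by
    rw [integral_congr_ae (g := fun _ => (1 : ℝ))]
    · simp
    · filter_upwards [hD.ae_pos z t'] with y hy
      rw [div_self hy.ne', Real.one_rpow]
  have hlt := hclose (a := (z, t, t')) (b := (z, t', t'))
    (by simpa only [Prod.dist_eq, dist_self, dist_nonneg, max_eq_left, max_eq_right] using htt')
  rw [hdiag, Real.dist_eq, abs_sub_lt_iff] at hlt
  rw [hD.lintegral_ratio_eq]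
  exact ENNReal.ofReal_le_ofReal (by linarith [hlt.1, Real.add_one_le_exp c])

theorem RatioRegularity.exists_forall_lintegral_ratio_le_exp [CompactSpace X]
    (hD : RatioRegularity f₀ f) :
    ∃ c : ℝ, ∀ (z : X) (t t' : Set.Icc (-M) M),
      ∫⁻ y, ENNReal.ofReal (f t y / f t' y) ∂(f₀ z).law ≤ ENNReal.ofReal (Real.exp c) := by
  obtain ⟨c, hc⟩ := (isCompact_range (hD.continuous_rpow 1 (by simp))).bddAbove
  refine ⟨c, fun z t t' => ?_⟩
  rw [hD.lintegral_ratio_eq]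
  refine ENNReal.ofReal_le_ofReal (le_trans (hc ⟨(z, t, t'), rfl⟩) ?_)
  linarith [Real.add_one_le_exp c]

instance : IsProbabilityMeasure (trueLaw f₀ x) := by
  unfold trueLaw
  infer_instance

theorem likelihoodRatio_nonneg (a b : C(X, Set.Icc (-M) M)) (n : ℕ) (y : ℕ → Y) :
    0 ≤ likelihoodRatio f x a b n y :=
  Finset.prod_nonneg fun _ _ => ratio_nonneg f _ _ _

theorem likelihoodRatio_eq_mul {a b c : C(X, Set.Icc (-M) M)} {y : ℕ → Y}
    (hb : ∀ i, 0 < f (b (x i)) (y i)) (n : ℕ) :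
    likelihoodRatio f x a c n y = likelihoodRatio f x a b n y * likelihoodRatio f x b c n y := by
  simp_rw [likelihoodRatio, ← Finset.prod_mul_distrib]
  refine Finset.prod_congr rfl fun i _ => ?_
  rw [mul_comm, div_mul_div_cancel₀ (hb i).ne']

theorem inv_likelihoodRatio (a b : C(X, Set.Icc (-M) M)) (n : ℕ) (y : ℕ → Y) :
    (likelihoodRatio f x a b n y)⁻¹ = likelihoodRatio f x b a n y := by
  simp_rw [likelihoodRatio, ← Finset.prod_inv_distrib, inv_div]

theorem measurable_likelihoodRatio (f : Set.Icc (-M) M → ProbDensity μ) (x : ℕ → X)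
    (a b : C(X, Set.Icc (-M) M)) (n : ℕ) : Measurable (likelihoodRatio f x a b n) := by
  unfold likelihoodRatio
  exact Finset.measurable_fun_prod _ fun i _ =>
    (measurable_ratio f _ _).comp (measurable_pi_apply i)

theorem lintegral_likelihoodRatio_rpow (f₀ : X → ProbDensity μ)
    (f : Set.Icc (-M) M → ProbDensity μ) (x : ℕ → X) (a b : C(X, Set.Icc (-M) M)) (n : ℕ) {p : ℝ}
    (hp : 0 ≤ p) :
    ∫⁻ y, ENNReal.ofReal (likelihoodRatio f x a b n y) ^ p ∂trueLaw f₀ x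
      = ∏ i ∈ Finset.range n,
        ∫⁻ u, ENNReal.ofReal (f (b (x i)) u / f (a (x i)) u) ^ p ∂(f₀ (x i)).law := by
  simp_rw [likelihoodRatio, ENNReal.ofReal_prod_of_nonneg fun _ _ => ratio_nonneg f _ _ _,
    ← ENNReal.prod_rpow_of_nonneg hp]
  exact lintegral_prod_infinitePi
    (fun i => (measurable_ratio f (b (x i)) (a (x i))).ennreal_ofReal.pow_const p) _

theorem lintegral_likelihoodRatio_le {a b : C(X, Set.Icc (-M) M)} {c : ℝ}
    (h : ∀ z : X, ∫⁻ u, ENNReal.ofReal (f (b z) u / f (a z) u) ∂(f₀ z).law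
      ≤ ENNReal.ofReal (Real.exp c)) (n : ℕ) :
    ∫⁻ y, ENNReal.ofReal (likelihoodRatio f x a b n y) ∂trueLaw f₀ x
      ≤ ENNReal.ofReal (Real.exp (n * c)) := by
  have hprod := lintegral_likelihoodRatio_rpow f₀ f x a b n zero_le_one
  simp only [ENNReal.rpow_one] at hprod
  rw [hprod, Real.exp_nat_mul, ENNReal.ofReal_pow (Real.exp_nonneg _)]
  exact (Finset.prod_le_pow_card _ _ _ fun i _ => h (x i)).trans_eq (by rw [Finset.card_range])

theorem RatioRegularity.ae_forall_pos (hD : RatioRegularity f₀ f) (a : C(X, Set.Icc (-M) M)) :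
    ∀ᵐ y ∂trueLaw f₀ x, ∀ i : ℕ, 0 < f (a (x i)) (y i) :=
  ae_all_iff.2 fun i => (measurePreserving_eval_infinitePi
    (fun i => (f₀ (x i)).law) i).quasiMeasurePreserving.ae (hD.ae_pos (x i) (a (x i)))

theorem RatioRegularity.ae_likelihoodRatio_pos (hD : RatioRegularity f₀ f)
    (a b : C(X, Set.Icc (-M) M)) :
    ∀ᵐ y ∂trueLaw f₀ x, ∀ n : ℕ, 0 < likelihoodRatio f x a b n y := by
  filter_upwards [hD.ae_forall_pos a, hD.ae_forall_pos b] with y ha hb n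
  exact Finset.prod_pos fun i _ => div_pos (hb i) (ha i)

theorem exists_expGrowthSup_lintegral_likelihoodRatio_rpow_le [CompactSpace X]
    (hB : DesignCondition x) {θstar : C(X, Set.Icc (-M) M)} (hD : RatioRegularity f₀ f)
    (hE : KLSeparation f₀ f θstar) {θ : C(X, Set.Icc (-M) M)} (hne : θ ≠ θstar) :
    ∃ κ > 0, ∃ p > 0, expGrowthSup (fun n =>
      ∫⁻ y, ENNReal.ofReal (likelihoodRatio f x θstar θ n y) ^ p ∂trueLaw f₀ x)
        ≤ (p * -κ : ℝ) := by
  obtain ⟨z₀, hz₀⟩ := DFunLike.ne_iff.1 hne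
  set φ : X → ℝ := fun z => ∫ y, Real.log (f (θ z) y / f (θstar z) y) ∂(f₀ z).law
  have hφ : Continuous φ := hD.continuous_log.comp (f := fun z : X => (z, θ z, θstar z))
    (by fun_prop)
  obtain ⟨κ, hκ, hsum⟩ := hB.exists_eventually_sum_le hφ.continuousAt
    (fun z => hE.integral_log_nonpos z _) (hE.integral_log_neg hz₀)
  obtain ⟨p, hp, hmoment⟩ := hD.exists_forall_lintegral_rpow_le θstar θ (half_pos hκ)
  refine ⟨κ / 2, half_pos hκ, p, hp.1, expGrowthSup_le_of_le_ofReal_exp ?_⟩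
  filter_upwards [hsum] with n hn
  calc ∫⁻ y, ENNReal.ofReal (likelihoodRatio f x θstar θ n y) ^ p ∂trueLaw f₀ x
    _ ≤ ∏ i ∈ Finset.range n, ENNReal.ofReal (Real.exp (p * (φ (x i) + κ / 2))) := by
      rw [lintegral_likelihoodRatio_rpow f₀ f x θstar θ n hp.1.le]
      exact Finset.prod_le_prod' fun i _ => hmoment (x i)
    _ = ENNReal.ofReal (Real.exp (p * (∑ i ∈ Finset.range n, φ (x i) + n * (κ / 2)))) := by
      rw [← ENNReal.ofReal_prod_of_nonneg fun i _ => Real.exp_nonneg _, ← Real.exp_sum,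
        ← Finset.mul_sum, Finset.sum_add_distrib, Finset.sum_const, Finset.card_range,
        nsmul_eq_mul]
    _ ≤ ENNReal.ofReal (Real.exp (n * (p * -(κ / 2)))) := by
      refine ENNReal.ofReal_le_ofReal (Real.exp_le_exp.2 ?_)
      linarith [mul_le_mul_of_nonneg_left hn hp.1.le]

theorem exists_ae_expGrowthSup_likelihoodRatio_le [CompactSpace X]
    (hB : DesignCondition x) {θstar : C(X, Set.Icc (-M) M)} (hD : RatioRegularity f₀ f)
    (hE : KLSeparation f₀ f θstar) {θ : C(X, Set.Icc (-M) M)} (hne : θ ≠ θstar) :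
    ∃ κ > (0 : ℝ), ∀ᵐ y ∂trueLaw f₀ x,
      expGrowthSup (fun n => ENNReal.ofReal (likelihoodRatio f x θstar θ n y)) ≤ (-κ : ℝ) := by
  obtain ⟨κ, hκ, p, hp, hrate⟩ :=
    exists_expGrowthSup_lintegral_likelihoodRatio_rpow_le hB hD hE hne
  exact ⟨κ, hκ, ae_expGrowthSup_le_of_expGrowthSup_lintegral_rpow_le
    (fun n => (measurable_likelihoodRatio f x θstar θ n).ennreal_ofReal.aemeasurable) hp hrate⟩

section Mixture

variable [MeasurableSpace C(X, Set.Icc (-M) M)] [BorelSpace C(X, Set.Icc (-M) M)]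
  {T : Type*} [MeasurableSpace T] {ν : Measure T} {a b : T → C(X, Set.Icc (-M) M)}

theorem measurable_uncurry_likelihoodRatio
    (hf : Measurable fun p : Set.Icc (-M) M × Y => f p.1 p.2) (x : ℕ → X)
    (ha : Measurable a) (hb : Measurable b) (n : ℕ) :
    Measurable fun p : T × (ℕ → Y) => likelihoodRatio f x (a p.1) (b p.1) n p.2 := by
  have hdensity (i : ℕ) {c : T → C(X, Set.Icc (-M) M)} (hc : Measurable c) :
      Measurable fun p : T × (ℕ → Y) => f (c p.1 (x i)) (p.2 i) :=
    hf.comp (((continuous_eval_const (x i)).measurable.comp (hc.comp measurable_fst)).prodMk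
      ((measurable_pi_apply i).comp measurable_snd))
  unfold likelihoodRatio
  exact Finset.measurable_fun_prod _ fun i _ => (hdensity i hb).div (hdensity i ha)

theorem measurable_lintegral_likelihoodRatio [SFinite ν]
    (hf : Measurable fun p : Set.Icc (-M) M × Y => f p.1 p.2) (x : ℕ → X)
    (ha : Measurable a) (hb : Measurable b) (n : ℕ) :
    Measurable fun y => ∫⁻ θ, ENNReal.ofReal (likelihoodRatio f x (a θ) (b θ) n y) ∂ν :=
  (measurable_uncurry_likelihoodRatio hf x ha hb n).ennreal_ofReal.lintegral_prod_left

theorem lintegral_lintegral_likelihoodRatio_le [SFinite ν]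
    (hf : Measurable fun p : Set.Icc (-M) M × Y => f p.1 p.2)
    (ha : Measurable a) (hb : Measurable b) {c : ℝ}
    (h : ∀ᵐ θ ∂ν, ∀ z : X, ∫⁻ u, ENNReal.ofReal (f (b θ z) u / f (a θ z) u) ∂(f₀ z).law
      ≤ ENNReal.ofReal (Real.exp c)) (n : ℕ) :
    ∫⁻ y, ∫⁻ θ, ENNReal.ofReal (likelihoodRatio f x (a θ) (b θ) n y) ∂ν ∂trueLaw f₀ x
      ≤ ν Set.univ * ENNReal.ofReal (Real.exp (n * c)) := by
  rw [lintegral_lintegral_swap ((measurable_uncurry_likelihoodRatio hf x ha hb n).comp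
    measurable_swap).ennreal_ofReal.aemeasurable, mul_comm, ← lintegral_const]
  exact lintegral_mono_ae (h.mono fun θ hθ => lintegral_likelihoodRatio_le hθ n)

theorem ae_expGrowthSup_lintegral_likelihoodRatio_le [IsFiniteMeasure ν]
    (hf : Measurable fun p : Set.Icc (-M) M × Y => f p.1 p.2)
    (ha : Measurable a) (hb : Measurable b) {c : ℝ}
    (h : ∀ᵐ θ ∂ν, ∀ z : X, ∫⁻ u, ENNReal.ofReal (f (b θ z) u / f (a θ z) u) ∂(f₀ z).law
      ≤ ENNReal.ofReal (Real.exp c)) :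
    ∀ᵐ y ∂trueLaw f₀ x, expGrowthSup (fun n =>
      ∫⁻ θ, ENNReal.ofReal (likelihoodRatio f x (a θ) (b θ) n y) ∂ν) ≤ c := by
  filter_upwards [ae_expGrowthSup_le_expGrowthSup_lintegral fun n =>
    (measurable_lintegral_likelihoodRatio (ν := ν) hf x ha hb n).aemeasurable] with y hy
  exact hy.trans <|
    (expGrowthSup_le_of_eventually_le (measure_ne_top ν Set.univ)
      (Eventually.of_forall (lintegral_lintegral_likelihoodRatio_le hf ha hb h))).trans
    (expGrowthSup_le_of_le_ofReal_exp (Eventually.of_forall fun _ => le_rfl))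

end Mixture

section Evidence

variable [MeasurableSpace C(X, Set.Icc (-M) M)] {Θ : Set C(X, Set.Icc (-M) M)}
  {prior : Measure Θ} {θstar : Θ}

theorem partialEvidence_eq_mul {θ₁ : C(X, Set.Icc (-M) M)} {y : ℕ → Y}
    (hpos : ∀ i, 0 < f (θ₁ (x i)) (y i)) (S : Set Θ) (n : ℕ) :
    partialEvidence f x prior θstar S n y
      = ENNReal.ofReal (likelihoodRatio f x θstar θ₁ n y) *
        ∫⁻ θ in S, ENNReal.ofReal (likelihoodRatio f x θ₁ θ n y) ∂prior := by
  rw [← lintegral_const_mul' _ _ ENNReal.ofReal_ne_top, partialEvidence]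
  simp_rw [← ENNReal.ofReal_mul (likelihoodRatio_nonneg _ _ _ _), ← likelihoodRatio_eq_mul hpos]

variable [BorelSpace C(X, Set.Icc (-M) M)]

theorem exists_nhds_ae_expGrowthSup_partialEvidence_le [CompactSpace X] [IsFiniteMeasure prior]
    (hf : Measurable fun p : Set.Icc (-M) M × Y => f p.1 p.2)
    (hB : DesignCondition x) (hD : RatioRegularity f₀ f)
    (hE : KLSeparation f₀ f θstar) {θ₁ : Θ} (hne : θ₁ ≠ θstar) :
    ∃ S ∈ 𝓝 θ₁, ∃ c < (0 : EReal), ∀ᵐ y ∂trueLaw f₀ x,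
      expGrowthSup (fun n => partialEvidence f x prior θstar S n y) ≤ c := by
  obtain ⟨κ, hκ, hpoint⟩ :=
    exists_ae_expGrowthSup_likelihoodRatio_le hB hD hE (Subtype.coe_ne_coe.2 hne)
  obtain ⟨η, hη, hclose⟩ := hD.exists_lintegral_ratio_le_exp (half_pos hκ)
  have hball : ∀ᵐ y ∂trueLaw f₀ x, expGrowthSup (fun n => ∫⁻ θ in Metric.ball θ₁ η,
      ENNReal.ofReal (likelihoodRatio f x θ₁ (θ : Θ) n y) ∂prior) ≤ (κ / 2 : ℝ) :=
    ae_expGrowthSup_lintegral_likelihoodRatio_le hf measurable_const measurable_subtype_coe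
      (ae_restrict_of_forall_mem Metric.isOpen_ball.measurableSet fun θ hθ z =>
        hclose z _ _ ((ContinuousMap.dist_apply_le_dist z).trans_lt hθ))
  refine ⟨Metric.ball θ₁ η, Metric.ball_mem_nhds _ hη, (-κ + κ / 2 : ℝ),
    EReal.coe_neg'.2 (by linarith), ?_⟩
  filter_upwards [hpoint, hball, hD.ae_forall_pos (x := x) (θ₁ : C(X, Set.Icc (-M) M))]
    with y hy_point hy_ball hpos
  simp_rw [partialEvidence_eq_mul hpos]
  rw [EReal.coe_add]
  exact (expGrowthSup_mul_le (.inr (hy_ball.trans_lt (EReal.coe_lt_top _)).ne)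
    (.inl (hy_point.trans_lt (EReal.coe_lt_top _)).ne)).trans (add_le_add hy_point hy_ball)

theorem exists_ae_expGrowthSup_partialEvidence_le [CompactSpace X] [IsFiniteMeasure prior]
    (hf : Measurable fun p : Set.Icc (-M) M × Y => f p.1 p.2)
    (hB : DesignCondition x) (hD : RatioRegularity f₀ f)
    (hE : KLSeparation f₀ f θstar) {K : Set Θ} (hK : IsCompact K) (hθstar : θstar ∉ K) :
    ∃ c < (0 : EReal), ∀ᵐ y ∂trueLaw f₀ x,
      expGrowthSup (fun n => partialEvidence f x prior θstar K n y) ≤ c := by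
  refine hK.induction_on (p := fun S => ∃ c < (0 : EReal), ∀ᵐ y ∂trueLaw f₀ x,
    expGrowthSup (fun n => partialEvidence f x prior θstar S n y) ≤ c) ?_ ?_ ?_ ?_
  · refine ⟨⊥, EReal.bot_lt_zero, Eventually.of_forall fun y => ?_⟩
    simp only [partialEvidence, Measure.restrict_empty, lintegral_zero_measure]
    exact expGrowthSup_zero.le
  · rintro S T hST ⟨c, hc, hT⟩
    exact ⟨c, hc, hT.mono fun y hy =>
      (expGrowthSup_monotone fun n => lintegral_mono_set hST).trans hy⟩
  · rintro S T ⟨c, hc, hS⟩ ⟨c', hc', hT⟩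
    refine ⟨c ⊔ c', max_lt hc hc', ?_⟩
    filter_upwards [hS, hT] with y hyS hyT
    calc expGrowthSup (fun n => partialEvidence f x prior θstar (S ∪ T) n y)
      _ ≤ expGrowthSup ((fun n => partialEvidence f x prior θstar S n y)
          + fun n => partialEvidence f x prior θstar T n y) :=
        expGrowthSup_monotone fun n => lintegral_union_le _ _ _
      _ ≤ c ⊔ c' := expGrowthSup_add.trans_le (sup_le_sup hyS hyT)
  · intro θ₁ hθ₁
    obtain ⟨S, hS, hrate⟩ := exists_nhds_ae_expGrowthSup_partialEvidence_le (prior := prior)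
      hf hB hD hE (ne_of_mem_of_not_mem hθ₁ hθstar)
    exact ⟨S, mem_nhdsWithin_of_mem_nhds hS, hrate⟩

theorem measurable_ofReal_likelihoodRatio
    (hf : Measurable fun p : Set.Icc (-M) M × Y => f p.1 p.2) (x : ℕ → X) (θstar : Θ) (n : ℕ)
    (y : ℕ → Y) : Measurable fun θ : Θ => ENNReal.ofReal (likelihoodRatio f x θstar θ n y) :=
  ((measurable_uncurry_likelihoodRatio hf x measurable_const measurable_subtype_coe n).comp
    measurable_prodMk_right).ennreal_ofReal

theorem ae_ae_likelihoodRatio_pos [SFinite prior]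
    (hf : Measurable fun p : Set.Icc (-M) M × Y => f p.1 p.2) (hD : RatioRegularity f₀ f)
    (θstar : Θ) :
    ∀ᵐ y ∂trueLaw f₀ x, ∀ᵐ θ ∂prior, ∀ n, 0 < likelihoodRatio f x θstar (θ : Θ) n y := by
  have hmeas (n : ℕ) : MeasurableSet {p : Θ × (ℕ → Y) |
      0 < likelihoodRatio f x θstar (p.1 : Θ) n p.2} :=
    measurableSet_lt measurable_const
      (measurable_uncurry_likelihoodRatio hf x measurable_const measurable_subtype_coe n)
  refine (Measure.ae_ae_comm ?_).1 (Eventually.of_forall fun θ => hD.ae_likelihoodRatio_pos _ _)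
  simpa only [Set.ofPred_forall] using MeasurableSet.iInter hmeas

theorem ae_partialEvidence_univ_pos [SFinite prior] [NeZero prior]
    (hf : Measurable fun p : Set.Icc (-M) M × Y => f p.1 p.2) (hD : RatioRegularity f₀ f)
    (θstar : Θ) :
    ∀ᵐ y ∂trueLaw f₀ x, ∀ n, 0 < partialEvidence f x prior θstar Set.univ n y := by
  filter_upwards [ae_ae_likelihoodRatio_pos (prior := prior) hf hD θstar] with y hy n
  rw [partialEvidence, Measure.restrict_univ, pos_iff_ne_zero, Ne, lintegral_eq_zero_iff
    (measurable_ofReal_likelihoodRatio hf x θstar n y)]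
  intro hzero
  obtain ⟨θ, hθ, hθ_pos⟩ := (hzero.and hy).exists
  exact (ENNReal.ofReal_pos.2 (hθ_pos n)).ne' hθ

theorem ae_partialEvidence_univ_lt_top [CompactSpace X] [IsFiniteMeasure prior]
    (hf : Measurable fun p : Set.Icc (-M) M × Y => f p.1 p.2) (hD : RatioRegularity f₀ f)
    (θstar : Θ) :
    ∀ᵐ y ∂trueLaw f₀ x, ∀ n, partialEvidence f x prior θstar Set.univ n y < ∞ := by
  obtain ⟨c, hc⟩ := hD.exists_forall_lintegral_ratio_le_exp
  refine ae_all_iff.2 fun n => ?_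
  simp_rw [partialEvidence, Measure.restrict_univ]
  refine ae_lt_top
    (measurable_lintegral_likelihoodRatio hf x measurable_const measurable_subtype_coe n)
    (ne_top_of_le_ne_top ?_ (lintegral_lintegral_likelihoodRatio_le hf measurable_const
      measurable_subtype_coe (Eventually.of_forall fun θ z => hc z _ _) n))
  exact ENNReal.mul_ne_top (measure_ne_top _ _) ENNReal.ofReal_ne_top

theorem ae_neg_le_expGrowthInf_partialEvidence_univ [CompactSpace X] [IsFiniteMeasure prior]
    (hf : Measurable fun p : Set.Icc (-M) M × Y => f p.1 p.2)
    (hsupp : InSupNormSupport prior θstar) (hD : RatioRegularity f₀ f) {c : ℝ} (hc : 0 < c) :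
    ∀ᵐ y ∂trueLaw f₀ x,
      (-c : ℝ) ≤ expGrowthInf fun n => partialEvidence f x prior θstar Set.univ n y := by
  obtain ⟨η, hη, hclose⟩ := hD.exists_lintegral_ratio_le_exp hc
  set B : Set Θ := Metric.ball θstar η
  have hB_pos : 0 < prior B := by
    have h := hsupp η hη
    simp_rw [supDist_eq_dist] at h
    exact h
  have : NeZero (prior.restrict B) := ⟨Measure.restrict_eq_zero.not.2 hB_pos.ne'⟩
  have hreverse : ∀ᵐ y ∂trueLaw f₀ x, expGrowthSup (fun n => ∫⁻ θ in B,
      ENNReal.ofReal (likelihoodRatio f x (θ : Θ) θstar n y) ∂prior) ≤ c :=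
    ae_expGrowthSup_lintegral_likelihoodRatio_le hf measurable_subtype_coe measurable_const
      (ae_restrict_of_forall_mem Metric.isOpen_ball.measurableSet fun θ hθ z =>
        hclose z _ _ ((ContinuousMap.dist_apply_le_dist z).trans_lt (Metric.mem_ball'.1 hθ)))
  filter_upwards [hreverse, ae_ae_likelihoodRatio_pos (prior := prior.restrict B) hf hD θstar]
    with y hy hpos
  have hinv (n : ℕ) : ∫⁻ θ in B, ENNReal.ofReal (likelihoodRatio f x (θ : Θ) θstar n y) ∂prior
      = ∫⁻ θ in B, (ENNReal.ofReal (likelihoodRatio f x θstar (θ : Θ) n y))⁻¹ ∂prior := by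
    refine lintegral_congr_ae (hpos.mono fun θ hθ => ?_)
    simp only [← ENNReal.ofReal_inv_of_pos (hθ n), inv_likelihoodRatio]
  simp_rw [hinv] at hy
  calc ((-c : ℝ) : EReal)
    _ ≤ expGrowthInf fun n => partialEvidence f x prior θstar B n y :=
      (EReal.neg_le_neg_iff.2 hy).trans <| neg_expGrowthSup_lintegral_inv_le
        (fun n => (measurable_ofReal_likelihoodRatio hf x θstar n y).aemeasurable)
        (fun n => hpos.mono fun θ hθ => (ENNReal.ofReal_pos.2 (hθ n)).ne')
        (fun n => Eventually.of_forall fun _ => ENNReal.ofReal_ne_top)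
    _ ≤ expGrowthInf fun n => partialEvidence f x prior θstar Set.univ n y :=
      expGrowthInf_monotone fun n => lintegral_mono_set (Set.subset_univ B)

theorem ae_expGrowthInf_partialEvidence_univ_nonneg [CompactSpace X] [IsFiniteMeasure prior]
    (hf : Measurable fun p : Set.Icc (-M) M × Y => f p.1 p.2)
    (hsupp : InSupNormSupport prior θstar) (hD : RatioRegularity f₀ f) :
    ∀ᵐ y ∂trueLaw f₀ x,
      0 ≤ expGrowthInf fun n => partialEvidence f x prior θstar Set.univ n y := by
  have hae := ae_all_iff.2 fun k : ℕ =>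
    ae_neg_le_expGrowthInf_partialEvidence_univ (x := x) hf hsupp hD (c := 1 / ((k : ℝ) + 1))
      Nat.one_div_pos_of_nat
  have hlim : Tendsto (fun k : ℕ => ((-(1 / ((k : ℝ) + 1)) : ℝ) : EReal)) atTop (𝓝 0) := by
    rw [← EReal.coe_zero, EReal.tendsto_coe, ← neg_zero]
    exact tendsto_one_div_add_atTop_nhds_zero_nat.neg
  filter_upwards [hae] with y hy using le_of_tendsto' hlim hy

end Evidence

end Model

end INID

theorem mainTheorem11_general
    {E : Type*} [NormedAddCommGroup E] {X : Set E} [CompactSpace X]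
    {Y : Type*} [MeasurableSpace Y] {μ : Measure Y} {M : ℝ}
    {f₀ : X → ProbDensity μ} {f : Set.Icc (-M) M → ProbDensity μ}
    (hf : Measurable fun p : Set.Icc (-M) M × Y => f p.1 p.2)
    [MeasurableSpace C(X, Set.Icc (-M) M)] [BorelSpace C(X, Set.Icc (-M) M)]
    {Θ : Set C(X, Set.Icc (-M) M)} {prior : Measure Θ} [IsFiniteMeasure prior]
    {x : ℕ → X} (hB : INID.DesignCondition x) {θstar : Θ}
    (hCsupp : INID.InSupNormSupport prior θstar) (hD : INID.RatioRegularity f₀ f)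
    (hE : INID.KLSeparation f₀ f θstar)
    {A : Set Θ} (hA : IsCompact (closure A)) (hθstar : θstar ∉ closure A) :
    ∃ c < (0 : EReal), ∀ᵐ y ∂INID.trueLaw f₀ x,
      (∀ n : ℕ, 0 < INID.partialEvidence f x prior θstar Set.univ n y ∧
        INID.partialEvidence f x prior θstar Set.univ n y < ∞) ∧
      ExpGrowth.expGrowthSup (fun n => INID.posterior f x prior θstar A n y) ≤ c := by
  have : NeZero prior := ⟨fun h => by simpa [h] using hCsupp 1 one_pos⟩
  obtain ⟨c, hc, hnumerator⟩ :=
    INID.exists_ae_expGrowthSup_partialEvidence_le (prior := prior) hf hB hD hE hA hθstar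
  refine ⟨c, hc, ?_⟩
  filter_upwards [hnumerator, INID.ae_expGrowthInf_partialEvidence_univ_nonneg hf hCsupp hD,
    INID.ae_partialEvidence_univ_pos (prior := prior) hf hD θstar,
    INID.ae_partialEvidence_univ_lt_top (prior := prior) hf hD θstar] with y hnum hden hpos hfin
  refine ⟨fun n => ⟨hpos n, hfin n⟩, (INID.expGrowthSup_div_le hden).trans (le_trans ?_ hnum)⟩
  exact ExpGrowth.expGrowthSup_monotone fun n => lintegral_mono_set subset_closure

theorem mainTheorem11
    {E : Type*} [NormedAddCommGroup E] [NormedSpace ℝ E] (X : Set E) [CompactSpace X]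
    {Y : Type*} [MeasurableSpace Y] (μ : Measure Y) [SigmaFinite μ] (M : ℝ)
    (f₀ : X → ProbDensity μ) (f : Set.Icc (-M) M → ProbDensity μ)
    (hf : Measurable fun p : Set.Icc (-M) M × Y => f p.1 p.2)
    [MeasurableSpace C(X, Set.Icc (-M) M)] [BorelSpace C(X, Set.Icc (-M) M)]
    (Θ : Set C(X, Set.Icc (-M) M)) (hΘ : IsCompact Θ)
    (prior : Measure Θ) [IsProbabilityMeasure prior]
    (x : ℕ → X) (hB : INID.DesignCondition x)
    (θstar : Θ) (hCmin : INID.IsKLMinimizer f₀ f θstar)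
    (hCsupp : INID.InSupNormSupport prior θstar)
    (hD : INID.RatioRegularity f₀ f)
    (hE : INID.KLSeparation f₀ f θstar)
    (ε : ℝ) (hε : 0 < ε) :
    ∀ᵐ y ∂INID.trueLaw f₀ x,
      (∀ n : ℕ, 0 < INID.partialEvidence f x prior θstar Set.univ n y ∧
        INID.partialEvidence f x prior θstar Set.univ n y < ∞) ∧
      Tendsto (fun n : ℕ => INID.posterior f x prior θstar
          {θ : Θ | ε < INID.supDist (θ : C(X, Set.Icc (-M) M)) θstar} n y)
        atTop (𝓝 0) := by
  have : CompactSpace Θ := isCompact_iff_compactSpace.1 hΘ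
  obtain ⟨c, hc, hrate⟩ := mainTheorem11_general hf hB hCsupp hD hE isClosed_closure.isCompact
    (INID.notMem_closure_lt_supDist θstar hε)
  filter_upwards [hrate] with y ⟨hevidence, hposterior⟩
  exact ⟨hevidence, INID.tendsto_zero_of_expGrowthSup_neg (hposterior.trans_lt hc)⟩
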